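/- \textbf{Proposition (average- versus worst-case min-entropy for extractors).} Let $n,m,d\in\mathbb{N}$, let $\mathsf{Ext}=\{f_s:[2^n]\to[2^m]\}_{s\in[2^d]}$ be any family of functions, and let $k\in\mathbb{R}$. All operators below act on a finite-dimensional complex Hilbert space $\mathcal{H}$ of arbitrary dimension, $\preceq$ is the Loewner order, and $\|X\|_1=\mathrm{Tr}\sqrt{X^\dagger X}$ is the trace norm. Define the worst-case quantum error $$\mathrm{Err}^*(\mathsf{Ext},k):=\sup\ \frac{1}{2^d}\sum_{i\in[2^n]}\ \sum_{(s,j)\in[2^d]\times[2^m]}\Big[\delta_{f_s(i)=j}-\frac{1}{2^m}\Big]\,\mathrm{Tr}\big[E_i\,\sigma^{1/2}D_{(s,j)}\,\sigma^{1/2}\big]$$ over all $\mathcal{H}$ and all operators $\sigma$, $E_i$, $D_{(s,j)}$ with $\sigma\succeq0$, $\mathrm{Tr}[\sigma]=1$, $0\preceq E_i\preceq 2^{-k}\mathbb{1}$ for all $i$, $\sum_iE_i=\mathbb{1}$, and $0\preceq D_{(s,j)}\preceq\mathbb{1}$ for all $(s,j)$. Define the average-case quantum error $$Q(\mathsf{Ext},k):=\sup\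 \frac12\cdot\frac{1}{2^d}\sum_{(s,j)\in[2^d]\times[2^m]}\Big\|\sum_{i\in[2^n]}\Big[\delta_{f_s(i)=j}-\frac{1}{2^m}\Big]\sigma_i\Big\|_1$$ over all $\mathcal{H}$ and all operators $\sigma_i$, $\omega$ with $\omega\succeq0$, $\mathrm{Tr}[\omega]=1$, $0\preceq\sigma_i\preceq2^{-k}\omega$ for all $i$, and $\sum_i\mathrm{Tr}[\sigma_i]=1$. (A supremum over an empty feasible set is $-\infty$.) Then for every $\varepsilon>0$, $$Q(\mathsf{Ext},k)\ \le\ \mathrm{Err}^*\!\Big(\mathsf{Ext},\,k-\log_2\big(1/\varepsilon^2+1\big)\Big)+\varepsilon .$$ -/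

import Mathlib

open scoped MatrixOrder

noncomputable section

/-- The trace norm `‖X‖₁ = Tr √(X† X)` of a square complex matrix. -/
def traceNorm {r : ℕ} (X : Matrix (Fin r) (Fin r) ℂ) : ℝ :=
  (CFC.sqrt (X.conjTranspose * X)).trace.re

/-- A (seeded) extractor: a family of functions `f_s : [2^n] → [2^m]` indexed by `s ∈ [2^d]`. -/
abbrev Extractor (n m d : ℕ) : Type := Fin (2 ^ d) → Fin (2 ^ n) → Fin (2 ^ m)

/-- The coefficient `δ_{f_s(i) = j} - 2^{-m}`. -/
def extCoeff {n m d : ℕ} (f : Extractor n m d)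
    (i : Fin (2 ^ n)) (s : Fin (2 ^ d)) (j : Fin (2 ^ m)) : ℝ :=
  (if f s i = j then 1 else 0) - 1 / 2 ^ m

/-- Feasible points `(σ, (E_i), (D_{(s,j)}))` on `ℂ^r` of the worst-case quantum program;
matrix inequalities are in the Loewner order. -/
structure WorstCaseFeasible {n m d : ℕ} (k : ℝ) {r : ℕ}
    (σ : Matrix (Fin r) (Fin r) ℂ)
    (E : Fin (2 ^ n) → Matrix (Fin r) (Fin r) ℂ)
    (D : Fin (2 ^ d) → Fin (2 ^ m) → Matrix (Fin r) (Fin r) ℂ) : Prop where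
  state_nonneg : 0 ≤ σ
  state_trace : σ.trace = 1
  source_nonneg : ∀ i, 0 ≤ E i
  source_le : ∀ i, E i ≤ ((2 : ℝ) ^ (-k)) • (1 : Matrix (Fin r) (Fin r) ℂ)
  source_sum : ∑ i, E i = 1
  test_nonneg : ∀ s j, 0 ≤ D s j
  test_le : ∀ s j, D s j ≤ 1

/-- The objective `2^{-d} ∑_{i,(s,j)} [δ_{f_s(i)=j} - 2^{-m}] Tr[E_i σ^{1/2} D_{(s,j)} σ^{1/2}]`. -/
def worstCaseObjective {n m d : ℕ} (f : Extractor n m d) {r : ℕ}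
    (σ : Matrix (Fin r) (Fin r) ℂ)
    (E : Fin (2 ^ n) → Matrix (Fin r) (Fin r) ℂ)
    (D : Fin (2 ^ d) → Fin (2 ^ m) → Matrix (Fin r) (Fin r) ℂ) : ℝ :=
  (1 / 2 ^ d) * ∑ i, ∑ s, ∑ j,
    extCoeff f i s j * (E i * CFC.sqrt σ * D s j * CFC.sqrt σ).trace.re

/-- `Err*(Ext, k)`: the supremum of the objective over all feasible points in all finite
dimensions, in the extended reals (so `⊥` if there is no feasible point). -/
def ErrStar {n m d : ℕ} (f : Extractor n m d) (k : ℝ) : EReal :=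
  sSup {v : EReal | ∃ (r : ℕ) (σ : Matrix (Fin r) (Fin r) ℂ)
    (E : Fin (2 ^ n) → Matrix (Fin r) (Fin r) ℂ)
    (D : Fin (2 ^ d) → Fin (2 ^ m) → Matrix (Fin r) (Fin r) ℂ),
    WorstCaseFeasible k σ E D ∧ v = ((worstCaseObjective f σ E D : ℝ) : EReal)}

/-- Feasible points `((σ_i), ω)` on `ℂ^r` of the average-case quantum program. -/
structure AverageCaseFeasible {n : ℕ} (k : ℝ) {r : ℕ}
    (σ : Fin (2 ^ n) → Matrix (Fin r) (Fin r) ℂ)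
    (ω : Matrix (Fin r) (Fin r) ℂ) : Prop where
  ref_nonneg : 0 ≤ ω
  ref_trace : ω.trace = 1
  nonneg : ∀ i, 0 ≤ σ i
  le_ref : ∀ i, σ i ≤ ((2 : ℝ) ^ (-k)) • ω
  trace_sum : ∑ i, (σ i).trace = 1

/-- The objective `½ · 2^{-d} ∑_{(s,j)} ‖∑_i [δ_{f_s(i)=j} - 2^{-m}] σ_i‖₁`. -/
def averageCaseObjective {n m d : ℕ} (f : Extractor n m d) {r : ℕ}
    (σ : Fin (2 ^ n) → Matrix (Fin r) (Fin r) ℂ) : ℝ :=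
  (1 / 2) * (1 / 2 ^ d) * ∑ s, ∑ j, traceNorm (∑ i, extCoeff f i s j • σ i)

/-- `Q(Ext, k)`: the supremum of the objective over all feasible points in all finite
dimensions, in the extended reals (so `⊥` if there is no feasible point). -/
def QExt {n m d : ℕ} (f : Extractor n m d) (k : ℝ) : EReal :=
  sSup {v : EReal | ∃ (r : ℕ) (σ : Fin (2 ^ n) → Matrix (Fin r) (Fin r) ℂ)
    (ω : Matrix (Fin r) (Fin r) ℂ),
    AverageCaseFeasible k σ ω ∧ v = ((averageCaseObjective f σ : ℝ) : EReal)}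

end

/-!
Replace an average-case source `(σᵢ)` by the mixture `σ'ᵢ = (1 - u) σᵢ + u tr(σᵢ) ω`. This costs
at most `2u`, because the advantage of any family of tests lies in `[-1, 1]`. The mixture still
satisfies `σ'ᵢ ≤ 2⁻ᵏ ω`, and now `u ω ≤ τ := ∑ᵢ σ'ᵢ`, so that `σ'ᵢ ≤ (2⁻ᵏ / u) τ`. The square-root
measurement `τ^{-1/2} σ'ᵢ τ^{-1/2}`, completed to a measurement on the kernel of `τ`, steers `τ` to
the `σ'ᵢ` and has effects bounded by `2⁻ᵏ / u`. The choice `1 / u = 1 / ε² + 1` gives `2u ≤ ε`.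
-/

open scoped ComplexOrder
open Matrix

section Loewner

variable {ι 𝕜 : Type*} [Fintype ι] [RCLike 𝕜]

lemma mul_eq_zero_of_nonneg_of_le {A B C : Matrix ι ι 𝕜} (hA : 0 ≤ A) (hAB : A ≤ B)
    (hBC : B * C = 0) : A * C = 0 := by
  classical
  have hCAC : star C * A * C = 0 := by
    refine le_antisymm ?_ (star_left_conjugate_nonneg hA C)
    calc star C * A * C ≤ star C * B * C := star_left_conjugate_le_conjugate hAB C
      _ = 0 := by rw [mul_assoc, hBC, mul_zero]
  obtain ⟨R, rfl⟩ := CStarAlgebra.nonneg_iff_eq_star_mul_self.mp hA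
  have hRC : R * C = 0 := by
    rwa [← conjTranspose_mul_self_eq_zero, conjTranspose_mul, ← mul_assoc, mul_assoc Cᴴ]
  rw [mul_assoc, hRC, mul_zero]

lemma trace_mul_nonneg {A B : Matrix ι ι 𝕜} (hA : 0 ≤ A) (hB : 0 ≤ B) : 0 ≤ (A * B).trace := by
  classical
  obtain ⟨R, rfl⟩ := CStarAlgebra.nonneg_iff_eq_star_mul_self.mp hA
  rw [trace_mul_cycle, trace_mul_comm, ← mul_assoc]
  exact (star_right_conjugate_nonneg hB R).posSemidef.trace_nonneg

lemma trace_mul_le_trace [DecidableEq ι] {A B : Matrix ι ι 𝕜} (hA : 0 ≤ A) (hB : B ≤ 1) :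
    (A * B).trace ≤ A.trace := by
  simpa [mul_sub] using trace_mul_nonneg hA (sub_nonneg.mpr hB)

end Loewner

section FunctionalCalculus

variable {ι 𝕜 : Type*} [Fintype ι] [DecidableEq ι] [RCLike 𝕜]

lemma cfc_mul_cfc (g h : ℝ → ℝ) (S : Matrix ι ι 𝕜) :
    cfc g S * cfc h S = cfc (fun x => g x * h x) S :=
  (cfc_mul g h S (S.finite_real_spectrum.continuousOn g)
    (S.finite_real_spectrum.continuousOn h)).symm

lemma exists_mul_eq_posPart {X : Matrix ι ι 𝕜} (hX : IsSelfAdjoint X) :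
    ∃ D : Matrix ι ι 𝕜, 0 ≤ D ∧ D ≤ 1 ∧ X * D = X⁺ := by
  let g : ℝ → ℝ := fun x => if 0 ≤ x then 1 else 0
  have hg : ∀ x, 0 ≤ g x ∧ g x ≤ 1 := fun x => by dsimp only [g]; split_ifs <;> simp
  refine ⟨cfc g X, cfc_nonneg fun x _ => (hg x).1, cfc_le_one g X fun x _ => (hg x).2, ?_⟩
  have hmul : (fun x => x * g x) = fun x => x⁺ := by
    ext x
    by_cases hx : 0 ≤ x
    · simp [g, hx]
    · simp [g, hx, posPart_eq_zero.mpr (not_le.mp hx).le]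
  calc X * cfc g X = cfc (fun x : ℝ => x) X * cfc g X := by rw [cfc_id' ℝ X]
    _ = X⁺ := by rw [cfc_mul_cfc, hmul, CFC.posPart_def, cfcₙ_eq_cfc]

/-- The Moore–Penrose inverse of a Hermitian matrix, inverting the nonzero eigenvalues. It is `0` on
matrices that are not Hermitian. -/
noncomputable def pinv (S : Matrix ι ι 𝕜) : Matrix ι ι 𝕜 := cfc (fun x : ℝ => x⁻¹) S

lemma isSelfAdjoint_pinv (S : Matrix ι ι 𝕜) : IsSelfAdjoint (pinv S) := cfc_predicate _ S

variable {S : Matrix ι ι 𝕜}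

lemma commute_pinv (hS : IsSelfAdjoint S) : Commute S (pinv S) := by
  have h : Commute (cfc (fun x : ℝ => x) S) (pinv S) := cfc_commute_cfc _ _ S
  rwa [cfc_id' ℝ S] at h

lemma mul_pinv_mul_self (hS : IsSelfAdjoint S) : S * pinv S * S = S := by
  have h : cfc (fun x : ℝ => x) S * pinv S * cfc (fun x : ℝ => x) S = cfc (fun x : ℝ => x) S := by
    simp only [pinv, cfc_mul_cfc, mul_inv_mul_cancel]
  rwa [cfc_id' ℝ S] at h

lemma isStarProjection_mul_pinv (hS : IsSelfAdjoint S) : IsStarProjection (S * pinv S) where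
  isIdempotentElem := by rw [IsIdempotentElem, ← mul_assoc, mul_pinv_mul_self hS]
  isSelfAdjoint := (hS.commute_iff (isSelfAdjoint_pinv S)).mp (commute_pinv hS)

lemma pinv_mul_mul_self_mul_pinv (hS : IsSelfAdjoint S) :
    pinv S * (S * S) * pinv S = S * pinv S := by
  rw [← mul_assoc, ← (commute_pinv hS).eq, mul_pinv_mul_self hS]

lemma mul_pinv_conj_mul {A : Matrix ι ι 𝕜} (hS : IsSelfAdjoint S) (hA : 0 ≤ A)
    (hAS : A ≤ S * S) : S * (pinv S * A * pinv S) * S = A := by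
  have hker : S * S * (1 - S * pinv S) = 0 := by
    rw [mul_assoc, mul_sub, mul_one, (commute_pinv hS).eq, ← mul_assoc S,
      mul_pinv_mul_self hS, sub_self, mul_zero]
  have hright : A * (S * pinv S) = A := by
    have h := mul_eq_zero_of_nonneg_of_le hA hAS hker
    rwa [mul_sub, mul_one, sub_eq_zero, eq_comm] at h
  have hleft : S * pinv S * A = A := by
    simpa only [star_mul, (isStarProjection_mul_pinv hS).isSelfAdjoint.star_eq, hA.star_eq]
      using congrArg star hright
  calc S * (pinv S * A * pinv S) * S = S * pinv S * A * (pinv S * S) := by noncomm_ring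
    _ = A := by rw [hleft, ← (commute_pinv hS).eq, hright]

end FunctionalCalculus

section Steering

variable {ι κ 𝕜 : Type*} [Fintype ι] [DecidableEq ι] [Fintype κ] [RCLike 𝕜]

/- The square-root measurement `S⁻¹ Aᵢ S⁻¹` with `S = √σ` sums to the support projection of `σ`; the
missing projection onto the kernel is distributed according to the weights `w`. -/
lemma exists_measurement_conj_sqrt_eq {A : κ → Matrix ι ι 𝕜} {σ : Matrix ι ι 𝕜} {w : κ → ℝ} {c : ℝ}
    (hA : ∀ i, 0 ≤ A i) (hAσ : ∀ i, A i ≤ c • σ) (hsum : ∑ i, A i = σ)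
    (hw : ∀ i, 0 ≤ w i) (hwc : ∀ i, w i ≤ c) (hwsum : ∑ i, w i = 1) :
    ∃ E : κ → Matrix ι ι 𝕜, (∀ i, 0 ≤ E i) ∧ (∀ i, E i ≤ c • 1) ∧ ∑ i, E i = 1 ∧
      ∀ i, CFC.sqrt σ * E i * CFC.sqrt σ = A i := by
  have hσ : 0 ≤ σ := hsum ▸ Finset.sum_nonneg fun i _ => hA i
  have hAσ' (i) : A i ≤ σ := hsum ▸ Finset.single_le_sum (fun i _ => hA i) (Finset.mem_univ i)
  set S := CFC.sqrt σ
  have hSS : S * S = σ := CFC.sqrt_mul_sqrt_self σ hσ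
  have hS : IsSelfAdjoint S := .of_nonneg (CFC.sqrt_nonneg σ)
  have hT := isSelfAdjoint_pinv S
  have hQ := (isStarProjection_mul_pinv hS).one_sub_nonneg
  have hTσT : pinv S * σ * pinv S = S * pinv S := by rw [← hSS, pinv_mul_mul_self_mul_pinv hS]
  refine ⟨fun i => pinv S * A i * pinv S + w i • (1 - S * pinv S), fun i => ?_, fun i => ?_, ?_,
    fun i => ?_⟩
  · exact add_nonneg (hT.conjugate_nonneg (hA i)) (smul_nonneg (hw i) hQ)
  · calc pinv S * A i * pinv S + w i • (1 - S * pinv S)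
        ≤ pinv S * (c • σ) * pinv S + c • (1 - S * pinv S) :=
          add_le_add (hT.conjugate_le_conjugate (hAσ i))
            (smul_le_smul_of_nonneg_right (hwc i) hQ)
      _ = c • 1 := by rw [mul_smul_comm, smul_mul_assoc, hTσT, ← smul_add, add_sub_cancel]
  · rw [Finset.sum_add_distrib, ← Finset.sum_mul, ← Finset.mul_sum, hsum, hTσT, ← Finset.sum_smul,
      hwsum, one_smul, add_sub_cancel]
  · have hSQ : S * (1 - S * pinv S) * S = 0 := by
      rw [mul_sub, sub_mul, mul_one, mul_assoc S, mul_pinv_mul_self hS, sub_self]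
    rw [mul_add, add_mul, mul_pinv_conj_mul hS (hA i) ((hAσ' i).trans_eq hSS.symm),
      mul_smul_comm, smul_mul_assoc, hSQ, smul_zero, add_zero]

end Steering

lemma exists_traceNorm_eq_two_mul_trace_sub_trace {r : ℕ} {X : Matrix (Fin r) (Fin r) ℂ}
    (hX : IsSelfAdjoint X) :
    ∃ D : Matrix (Fin r) (Fin r) ℂ, 0 ≤ D ∧ D ≤ 1 ∧
      traceNorm X = 2 * (X * D).trace.re - X.trace.re := by
  obtain ⟨D, hD0, hD1, hXD⟩ := exists_mul_eq_posPart hX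
  have habs : CFC.sqrt (Xᴴ * X) = 2 • (X * D) - X := by
    rw [hXD, ← CFC.abs_add_self X]
    exact (add_sub_cancel_right _ X).symm
  exact ⟨D, hD0, hD1, by simp [traceNorm, habs, two_mul]⟩

section Bias

variable {n m d : ℕ} (f : Extractor n m d)

lemma sum_extCoeff (i : Fin (2 ^ n)) (s : Fin (2 ^ d)) : ∑ j, extCoeff f i s j = 0 := by
  simp [extCoeff, Finset.sum_sub_distrib]

lemma abs_sum_extCoeff_mul_le (i : Fin (2 ^ n)) (s : Fin (2 ^ d)) {x : Fin (2 ^ m) → ℝ} {y : ℝ}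
    (hx : ∀ j, 0 ≤ x j) (hxy : ∀ j, x j ≤ y) : |∑ j, extCoeff f i s j * x j| ≤ y := by
  have hsplit : ∑ j, extCoeff f i s j * x j = x (f s i) - (∑ j, x j) / 2 ^ m := by
    simp [extCoeff, sub_mul, Finset.sum_sub_distrib, ← Finset.mul_sum, div_eq_inv_mul]
  have havg : (∑ j, x j) / 2 ^ m ≤ y := by
    have hsum := Finset.sum_le_card_nsmul Finset.univ x y fun j _ => hxy j
    rw [div_le_iff₀' (by positivity)]
    simpa using hsum
  rw [hsplit]
  exact abs_sub_le_of_nonneg_of_le (hx _) (hxy _)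
    (div_nonneg (Finset.sum_nonneg fun j _ => hx j) (by positivity)) havg

variable {ι : Type*} [Fintype ι]

/-- The advantage of the tests `D s j` in distinguishing the extractor output from uniform, where
`σ i` is the unnormalised state of the side information held when the source emits `i`. -/
noncomputable def testBias (σ : Fin (2 ^ n) → Matrix ι ι ℂ)
    (D : Fin (2 ^ d) → Fin (2 ^ m) → Matrix ι ι ℂ) : ℝ :=
  (1 / 2 ^ d) * ∑ i, ∑ s, ∑ j, extCoeff f i s j * (σ i * D s j).trace.re

lemma testBias_smul_add_smul (a b : ℝ) (σ ρ : Fin (2 ^ n) → Matrix ι ι ℂ)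
    (D : Fin (2 ^ d) → Fin (2 ^ m) → Matrix ι ι ℂ) :
    testBias f (a • σ + b • ρ) D = a * testBias f σ D + b * testBias f ρ D := by
  simp only [testBias, Finset.mul_sum, ← Finset.sum_add_distrib]
  refine Finset.sum_congr rfl fun i _ => Finset.sum_congr rfl fun s _ =>
    Finset.sum_congr rfl fun j _ => ?_
  simp only [Pi.add_apply, Pi.smul_apply, add_mul, smul_mul_assoc, trace_add, trace_smul,
    Complex.add_re, Complex.smul_re, smul_eq_mul]
  ring

lemma abs_testBias_le_one [DecidableEq ι] {σ : Fin (2 ^ n) → Matrix ι ι ℂ}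
    {D : Fin (2 ^ d) → Fin (2 ^ m) → Matrix ι ι ℂ} (hσ : ∀ i, 0 ≤ σ i)
    (hσsum : ∑ i, (σ i).trace = 1) (hD : ∀ s j, 0 ≤ D s j) (hD' : ∀ s j, D s j ≤ 1) :
    |testBias f σ D| ≤ 1 := by
  have hrow (i) (s) : |∑ j, extCoeff f i s j * (σ i * D s j).trace.re| ≤ (σ i).trace.re :=
    abs_sum_extCoeff_mul_le f i s
      (fun j => (Complex.le_def.mp (trace_mul_nonneg (hσ i) (hD s j))).1)
      (fun j => (Complex.le_def.mp (trace_mul_le_trace (hσ i) (hD' s j))).1)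
  have hsum : |∑ i, ∑ s, ∑ j, extCoeff f i s j * (σ i * D s j).trace.re| ≤ 2 ^ d := by
    calc |∑ i, ∑ s, ∑ j, extCoeff f i s j * (σ i * D s j).trace.re|
        ≤ ∑ i, ∑ _s : Fin (2 ^ d), (σ i).trace.re :=
          (Finset.abs_sum_le_sum_abs _ _).trans <| Finset.sum_le_sum fun i _ =>
            (Finset.abs_sum_le_sum_abs _ _).trans <| Finset.sum_le_sum fun s _ => hrow i s
      _ = 2 ^ d := by simp [← Finset.mul_sum, ← Complex.re_sum, hσsum]
  rw [testBias, abs_mul, abs_of_nonneg (by positivity), one_div, inv_mul_le_iff₀ (by positivity),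
    mul_one]
  exact hsum

variable {r : ℕ}

lemma worstCaseObjective_eq_testBias (σ : Matrix (Fin r) (Fin r) ℂ)
    (E : Fin (2 ^ n) → Matrix (Fin r) (Fin r) ℂ)
    (D : Fin (2 ^ d) → Fin (2 ^ m) → Matrix (Fin r) (Fin r) ℂ) :
    worstCaseObjective f σ E D = testBias f (fun i => CFC.sqrt σ * E i * CFC.sqrt σ) D := by
  have htrace (i) (s) (j) : (E i * CFC.sqrt σ * D s j * CFC.sqrt σ).trace
      = (CFC.sqrt σ * E i * CFC.sqrt σ * D s j).trace := by
    rw [trace_mul_comm, ← mul_assoc, ← mul_assoc]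
  simp only [worstCaseObjective, testBias, htrace]

lemma sum_trace_sum_extCoeff_smul (s : Fin (2 ^ d)) (σ : Fin (2 ^ n) → Matrix ι ι ℂ) :
    ∑ j, (∑ i, extCoeff f i s j • σ i).trace = 0 := by
  simp only [trace_sum, trace_smul]
  rw [Finset.sum_comm]
  simp only [← Finset.sum_smul, sum_extCoeff, zero_smul, Finset.sum_const_zero]

lemma testBias_eq_sum_re_trace_mul (σ : Fin (2 ^ n) → Matrix ι ι ℂ)
    (D : Fin (2 ^ d) → Fin (2 ^ m) → Matrix ι ι ℂ) :
    testBias f σ D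
      = (1 / 2 ^ d) * ∑ s, ∑ j, ((∑ i, extCoeff f i s j • σ i) * D s j).trace.re := by
  simp only [testBias, Finset.sum_mul, smul_mul_assoc, trace_sum, trace_smul, Complex.re_sum,
    Complex.smul_re, smul_eq_mul]
  rw [Finset.sum_comm (s := Finset.univ (α := Fin (2 ^ n)))]
  exact congrArg _ (Finset.sum_congr rfl fun s _ => Finset.sum_comm)

lemma exists_averageCaseObjective_eq_testBias {σ : Fin (2 ^ n) → Matrix (Fin r) (Fin r) ℂ}
    (hσ : ∀ i, IsSelfAdjoint (σ i)) :
    ∃ D : Fin (2 ^ d) → Fin (2 ^ m) → Matrix (Fin r) (Fin r) ℂ,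
      (∀ s j, 0 ≤ D s j) ∧ (∀ s j, D s j ≤ 1) ∧ averageCaseObjective f σ = testBias f σ D := by
  have hX (s) (j) : IsSelfAdjoint (∑ i, extCoeff f i s j • σ i) :=
    isSelfAdjoint_sum _ fun i _ => (IsSelfAdjoint.all _).smul (hσ i)
  choose D hD0 hD1 hD using fun s j => exists_traceNorm_eq_two_mul_trace_sub_trace (hX s j)
  refine ⟨D, hD0, hD1, ?_⟩
  have htrace (s) : ∑ j, (∑ i, extCoeff f i s j • σ i).trace.re = 0 := by
    rw [← Complex.re_sum, sum_trace_sum_extCoeff_smul, Complex.zero_re]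
  rw [averageCaseObjective, testBias_eq_sum_re_trace_mul]
  simp only [hD, Finset.sum_sub_distrib, htrace, sub_zero, ← Finset.mul_sum]
  ring

end Bias

namespace AverageCaseFeasible

variable {n m d r : ℕ} {k u : ℝ} {σ ρ : Fin (2 ^ n) → Matrix (Fin r) (Fin r) ℂ}
  {ω : Matrix (Fin r) (Fin r) ℂ}

lemma re_trace_nonneg (h : AverageCaseFeasible k σ ω) (i : Fin (2 ^ n)) : 0 ≤ (σ i).trace.re :=
  (Complex.le_def.mp (h.nonneg i).posSemidef.trace_nonneg).1

lemma sum_re_trace (h : AverageCaseFeasible k σ ω) : ∑ i, (σ i).trace.re = 1 := by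
  rw [← Complex.re_sum, h.trace_sum, Complex.one_re]

lemma re_trace_le (h : AverageCaseFeasible k σ ω) (i : Fin (2 ^ n)) :
    (σ i).trace.re ≤ (2 : ℝ) ^ (-k) := by
  have htrace := (sub_nonneg.mpr (h.le_ref i)).posSemidef.trace_nonneg
  rw [trace_sub, trace_smul, h.ref_trace, sub_nonneg] at htrace
  simpa using (Complex.le_def.mp htrace).1

lemma decouple (h : AverageCaseFeasible k σ ω) :
    AverageCaseFeasible k (fun i => (σ i).trace.re • ω) ω where
  ref_nonneg := h.ref_nonneg
  ref_trace := h.ref_trace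
  nonneg i := smul_nonneg (h.re_trace_nonneg i) h.ref_nonneg
  le_ref i := smul_le_smul_of_nonneg_right (h.re_trace_le i) h.ref_nonneg
  trace_sum := by
    simp only [trace_smul, h.ref_trace, ← Finset.sum_smul, h.sum_re_trace, one_smul]

lemma convexComb (hσ : AverageCaseFeasible k σ ω) (hρ : AverageCaseFeasible k ρ ω) {a b : ℝ}
    (ha : 0 ≤ a) (hb : 0 ≤ b) (hab : a + b = 1) : AverageCaseFeasible k (a • σ + b • ρ) ω where
  ref_nonneg := hσ.ref_nonneg
  ref_trace := hσ.ref_trace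
  nonneg i := add_nonneg (smul_nonneg ha (hσ.nonneg i)) (smul_nonneg hb (hρ.nonneg i))
  le_ref i := by
    calc a • σ i + b • ρ i ≤ a • (2 : ℝ) ^ (-k) • ω + b • (2 : ℝ) ^ (-k) • ω :=
          add_le_add (smul_le_smul_of_nonneg_left (hσ.le_ref i) ha)
            (smul_le_smul_of_nonneg_left (hρ.le_ref i) hb)
      _ = (2 : ℝ) ^ (-k) • ω := by rw [← add_smul, hab, one_smul]
  trace_sum := by
    simp only [Pi.add_apply, Pi.smul_apply, trace_add, trace_smul, Finset.sum_add_distrib,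
      ← Finset.smul_sum, hσ.trace_sum, hρ.trace_sum, ← add_smul, hab, one_smul]

lemma smul_ref_le_sum_convexComb_decouple (h : AverageCaseFeasible k σ ω) {a b : ℝ} (ha : 0 ≤ a) :
    b • ω ≤ ∑ i, (a • σ + b • fun i => (σ i).trace.re • ω) i := by
  simp only [Pi.add_apply, Pi.smul_apply, Finset.sum_add_distrib, ← Finset.smul_sum,
    ← Finset.sum_smul, h.sum_re_trace, one_smul]
  exact le_add_of_nonneg_left (smul_nonneg ha (Finset.sum_nonneg fun i _ => h.nonneg i))

lemma exists_worstCaseFeasible (h : AverageCaseFeasible k σ ω) (hu : 0 < u) (hu1 : u ≤ 1)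
    (hω : u • ω ≤ ∑ i, σ i) {D : Fin (2 ^ d) → Fin (2 ^ m) → Matrix (Fin r) (Fin r) ℂ}
    (hD : ∀ s j, 0 ≤ D s j) (hD' : ∀ s j, D s j ≤ 1) :
    ∃ E, WorstCaseFeasible (k + Real.logb 2 u) (∑ i, σ i) E D ∧
      ∀ f : Extractor n m d, worstCaseObjective f (∑ i, σ i) E D = testBias f σ D := by
  have hpow : (2 : ℝ) ^ (-(k + Real.logb 2 u)) = 2 ^ (-k) / u := by
    rw [neg_add', Real.rpow_sub two_pos, Real.rpow_logb two_pos (by norm_num) hu]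
  have hσ (i) : σ i ≤ ((2 : ℝ) ^ (-k) / u) • ∑ i, σ i := by
    calc σ i ≤ (2 : ℝ) ^ (-k) • ω := h.le_ref i
      _ = ((2 : ℝ) ^ (-k) / u) • u • ω := by rw [smul_smul, div_mul_cancel₀ _ hu.ne']
      _ ≤ ((2 : ℝ) ^ (-k) / u) • ∑ i, σ i := smul_le_smul_of_nonneg_left hω (by positivity)
  have hw (i) : (σ i).trace.re ≤ 2 ^ (-k) / u :=
    (h.re_trace_le i).trans (le_div_self (by positivity) hu hu1)
  obtain ⟨E, hE0, hE1, hEsum, hE⟩ :=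
    exists_measurement_conj_sqrt_eq h.nonneg hσ rfl h.re_trace_nonneg hw h.sum_re_trace
  refine ⟨E, ⟨Finset.sum_nonneg fun i _ => h.nonneg i, by rw [Matrix.trace_sum, h.trace_sum], hE0,
    by rwa [hpow], hEsum, hD, hD'⟩, fun f => ?_⟩
  simp only [worstCaseObjective_eq_testBias, hE]

end AverageCaseFeasible

theorem mainTheorem6_general {n m d : ℕ} (Ext : Extractor n m d) (k : ℝ) {u : ℝ} (hu : 0 < u)
    (hu1 : u ≤ 1) :
    QExt Ext k ≤ ErrStar Ext (k + Real.logb 2 u) + ((2 * u : ℝ) : EReal) := by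
  refine sSup_le ?_
  rintro _ ⟨r, σ, ω, hσ, rfl⟩
  obtain ⟨D, hD, hD', hobj⟩ :=
    exists_averageCaseObjective_eq_testBias Ext fun i => .of_nonneg (hσ.nonneg i)
  have hρ := hσ.decouple
  set ρ : Fin (2 ^ n) → Matrix (Fin r) (Fin r) ℂ := fun i => (σ i).trace.re • ω
  have hmix := hσ.convexComb hρ (sub_nonneg.mpr hu1) hu.le (sub_add_cancel 1 u)
  obtain ⟨E, hE, hEobj⟩ := hmix.exists_worstCaseFeasible hu hu1
    (hσ.smul_ref_le_sum_convexComb_decouple (sub_nonneg.mpr hu1)) hD hD'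
  have hσbias := (abs_le.mp (abs_testBias_le_one Ext hσ.nonneg hσ.trace_sum hD hD')).2
  have hρbias := (abs_le.mp (abs_testBias_le_one Ext hρ.nonneg hρ.trace_sum hD hD')).1
  have hloss : averageCaseObjective Ext σ
      ≤ worstCaseObjective Ext (∑ i, ((1 - u) • σ + u • ρ) i) E D + 2 * u := by
    rw [hobj, hEobj, testBias_smul_add_smul]
    nlinarith
  calc ((averageCaseObjective Ext σ : ℝ) : EReal)
      ≤ (worstCaseObjective Ext (∑ i, ((1 - u) • σ + u • ρ) i) E D : ℝ) + ((2 * u : ℝ) : EReal) :=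
        mod_cast hloss
    _ ≤ ErrStar Ext (k + Real.logb 2 u) + ((2 * u : ℝ) : EReal) := by
        gcongr
        exact le_sSup ⟨r, _, E, D, hE, rfl⟩

lemma two_mul_inv_one_div_sq_add_one_le {ε : ℝ} (hε : 0 < ε) : 2 * (1 / ε ^ 2 + 1)⁻¹ ≤ ε := by
  have hpos : 0 < 1 / ε ^ 2 + 1 := by positivity
  rw [← div_eq_mul_inv, div_le_iff₀ hpos]
  have hexpand : ε * (1 / ε ^ 2 + 1) - 2 = (ε - 1) ^ 2 / ε := by field_simp; ring
  have : 0 ≤ (ε - 1) ^ 2 / ε := by positivity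
  linarith

theorem mainTheorem6 (n m d : ℕ) (Ext : Extractor n m d) (k ε : ℝ) (hε : 0 < ε) :
    QExt Ext k ≤ ErrStar Ext (k - Real.logb 2 (1 / ε ^ 2 + 1)) + ((ε : ℝ) : EReal) := by
  have hbound : (1 : ℝ) ≤ 1 / ε ^ 2 + 1 := le_add_of_nonneg_left (by positivity)
  have hmain := mainTheorem6_general Ext k (inv_pos.mpr (one_pos.trans_le hbound))
    (inv_le_one_of_one_le₀ hbound)
  rw [Real.logb_inv, ← sub_eq_add_neg] at hmain
  exact hmain.trans (add_le_add_right (EReal.coe_le_coe_iff.mpr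
    (two_mul_inv_one_div_sq_add_one_le hε)) _)
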